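/- Let $H$ be a complex Hilbert space, with inner product conjugate linear in the first variable and linear in the second, and let $U$ be a unitary operator on $H$. Let $\mathbb{T}=\{z\in\mathbb{C}:|z|=1\}$, and let $L^\infty_0(\mathbb{T})$ be the $*$-algebra of bounded Borel measurable functions $f:\mathbb{T}\to\mathbb{C}$. For $f\in C(\mathbb{T})$, let $f(U)\in\mathcal{B}(H)$ be defined by the continuous calculus of $U$, that is, by the unique continuous homomorphism of algebras $C(\mathbb{T})\to\mathcal{B}(H)$ that sends the identity function $z\mapsto z$ to $U$. For $x\in H$ let $\mu_{x,x}$ be the finite positive Borel measure on $\mathbb{T}$ with $\langle x,f(U)x\rangle=\int_{\mathbb{T}}f\,d\mu_{x,x}$ for all $f\in C(\mathbb{T})$ (Riesz–Markov–Kakutani), and for $x,y\in H$ let $$\mu_{x,y}=\tfrac14\left(\mu_{x+y,x+y}-\mu_{x-y,x-y}-i\,\mu_{x+iy,x+iy}+i\,\mu_{x-iy,x-iy}\right),$$ the complex spectral measures of $U$ obtained by polarization. **A. Measurable calculus.** There is a unique linear map $\Lambda:L^\infty_0(\mathbb{T})\to\mathcal{B}(H)$, $\Lambda(f)=f(U)$,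 such that 1. $\Lambda(f)$ is the operator $f(U)$ of the continuous calculus if $f\in C(\mathbb{T})$; 2. if $f_n,f\in L^\infty_0(\mathbb{T})$, $\sup_n\sup_{z\in\mathbb{T}}|f_n(z)|<\infty$ and $f_n\to f$ pointwise, then $\Lambda(f_n)\to\Lambda(f)$ in the weak operator topology. Moreover, $\Lambda(fg)=\Lambda(f)\Lambda(g)$ and $\Lambda(f)^*=\Lambda(\overline{f})$ for all $f,g\in L^\infty_0(\mathbb{T})$, and for all $x,y\in H$ $$\langle x,f(U)y\rangle=\int_{\mathbb{T}}f\,d\mu_{x,y}.$$ **B. Projection valued measure.** For a Borel set $E\subseteq\mathbb{T}$ let $\mu(E)=\chi_E(U)$. Then $\langle x,\mu(E)y\rangle=\mu_{x,y}(E)$ for all $x,y\in H$, and $\mu$ is a projection valued measure on $\mathbb{T}$: each $\mu(E)$ is an orthogonal projection, $\mu(\emptyset)=0$, $\mu(\mathbb{T})=I$, and if $E_1,E_2,\dots$ are pairwise disjoint Borel sets, then $\mu\left(\bigcup_n E_n\right)=\sum_n\mu(E_n)$, with convergence in the strong operator topology. **C. Null sets and norms.** A Borel set $E$ is a null set of $\mu$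 if $\mu(E)=0$. For a Borel function $\varphi:\mathbb{T}\to\mathbb{C}$ let $\|\varphi\|_{L^\infty(\mu)}\in[0,\infty]$ be the infimum of the $C\in[0,\infty]$ such that $|\varphi|\le C$ outside a null set of $\mu$. 1. For a Borel set $E\subseteq\mathbb{T}$ the following are equivalent: (a) $\mu(E)=0$; (b) $\mu_{x,x}(E)=0$ for all $x\in H$; (c) $\mu_{x,y}(E)=0$ for all $x,y\in H$; and, for every given orthonormal basis $\{e_\alpha\}$ of $H$, (d) $\mu_{e_\alpha,e_\beta}(E)=0$ for all $\alpha,\beta$. 2. For every Borel function $\varphi:\mathbb{T}\to\mathbb{C}$, $\|\varphi\|_{L^\infty(\mu)}=\sup_{x\in H}\|\varphi\|_{L^\infty(\mu_{x,x})}$ in $[0,\infty]$. 3. For every $f\in L^\infty_0(\mathbb{T})$, $\|f(U)\|=\|f\|_{L^\infty(\mu)}$. -/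

import Mathlib

open MeasureTheory Filter Topology
open scoped ENNReal CompactlySupported

noncomputable section

namespace UnitaryCalculus

/-- The unit circle `𝕋 = {z ∈ ℂ : |z| = 1}`, with its Borel σ-algebra. -/
abbrev UnitCircle : Type := Metric.sphere (0 : ℂ) 1

/-- The space of bounded Borel measurable functions `𝕋 → ℂ` (actual functions, not classes modulo
null sets), as a star-subalgebra of the algebra of all functions. -/
def BoundedBorel : StarSubalgebra ℂ (UnitCircle → ℂ) where
  carrier := {f | Measurable f ∧ ∃ C : ℝ, ∀ z, ‖f z‖ ≤ C}
  mul_mem' := by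
    rintro f g ⟨hf, C, hC⟩ ⟨hg, D, hD⟩
    refine ⟨hf.mul hg, C * D, fun z => ?_⟩
    rw [Pi.mul_apply, norm_mul]
    exact mul_le_mul (hC z) (hD z) (norm_nonneg _) ((norm_nonneg _).trans (hC z))
  add_mem' := by
    rintro f g ⟨hf, C, hC⟩ ⟨hg, D, hD⟩
    exact ⟨hf.add hg, C + D, fun z => (norm_add_le _ _).trans (add_le_add (hC z) (hD z))⟩
  algebraMap_mem' := fun c => ⟨measurable_const, ‖c‖, fun _ => le_rfl⟩
  star_mem' := by
    rintro f ⟨hf, C, hC⟩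
    refine ⟨?_, C, fun z => ?_⟩
    · exact Complex.continuous_conj.measurable.comp hf
    · simpa using hC z

/-- A continuous function on the circle, seen as a bounded Borel function. -/
def BoundedBorel.ofContinuous (f : C(UnitCircle, ℂ)) : BoundedBorel :=
  ⟨f, f.continuous.measurable, ‖f‖, f.norm_coe_le_norm⟩

/-- The characteristic function of a Borel set, as a bounded Borel function. -/
def BoundedBorel.charFun (E : Set UnitCircle) (hE : MeasurableSet E) : BoundedBorel :=
  ⟨E.indicator 1, measurable_one.indicator hE, 1, fun z => by
    by_cases hz : z ∈ E <;> simp [hz]⟩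

variable {H : Type*} [NormedAddCommGroup H] [InnerProductSpace ℂ H] [CompleteSpace H]

/-! ### The continuous calculus -/

/-- The identity function `e(e^{it}) = e^{it}` of the circle. -/
def idFun : C(UnitCircle, ℂ) := ⟨Subtype.val, continuous_subtype_val⟩

lemma isStarNormal_unitary (U : unitary (H →L[ℂ] H)) : IsStarNormal (U : H →L[ℂ] H) :=
  isStarNormal_of_mem_unitary U.2

/-- The inclusion of the spectrum of a unitary operator in the circle. -/
def spectrumToCircle (U : unitary (H →L[ℂ] H)) :
    C(spectrum ℂ (U : H →L[ℂ] H), UnitCircle) :=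
  ⟨fun z => ⟨z, spectrum.subset_circle_of_unitary U.2 z.2⟩, by fun_prop⟩

/-- The continuous calculus `f ↦ f(U)`, `C(𝕋) → B(H)`, of a unitary operator `U`. -/
def contCalc (U : unitary (H →L[ℂ] H)) : C(UnitCircle, ℂ) →⋆ₐ[ℂ] (H →L[ℂ] H) :=
  (cfcHom (isStarNormal_unitary U)).comp
    (ContinuousMap.compStarAlgHom' ℂ ℂ (spectrumToCircle U))

lemma contCalc_idFun (U : unitary (H →L[ℂ] H)) : contCalc U idFun = U :=
  cfcHom_id (isStarNormal_unitary U)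

lemma norm_contCalc_le (U : unitary (H →L[ℂ] H)) (f : C(UnitCircle, ℂ)) :
    ‖contCalc U f‖ ≤ ‖f‖ := by
  change ‖cfcHom (isStarNormal_unitary U) (f.comp (spectrumToCircle U))‖ ≤ ‖f‖
  rw [norm_cfcHom _ _ (isStarNormal_unitary U)]
  exact (ContinuousMap.norm_le _ (norm_nonneg f)).2 fun z => f.norm_coe_le_norm _

/-- The continuous calculus is the only continuous homomorphism of algebras that sends the
identity function of the circle to `U`. -/
lemma contCalc_unique (U : unitary (H →L[ℂ] H)) (Φ : C(UnitCircle, ℂ) →ₐ[ℂ] (H →L[ℂ] H))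
    (hid : Φ idFun = U) (hcont : Continuous Φ) (f : C(UnitCircle, ℂ)) : Φ f = contCalc U f := by
  have hc : Continuous (contCalc U) :=
    AddMonoidHomClass.continuous_of_bound (contCalc U) 1 fun f => by
      simpa using norm_contCalc_le U f
  have h1 : idFun * star idFun = 1 := by
    ext z
    have hz : ‖(z : ℂ)‖ = 1 := by simp
    simp [idFun, Complex.mul_conj', hz]
  have key : ∀ g ∈ Algebra.adjoin ℂ ({idFun} ∪ star {idFun}), Φ g = contCalc U g := by
    intro g hg
    induction hg using Algebra.adjoin_induction with
    | mem g hg =>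
      rcases hg with hg | hg
      · rw [Set.mem_singleton_iff.1 hg, hid, contCalc_idFun]
      · have hg' : g = star idFun := by
          rw [← Set.mem_singleton_iff.1 (Set.mem_star.1 hg), star_star]
        have h2 : (U : H →L[ℂ] H) * Φ (star idFun) = 1 := by rw [← hid, ← map_mul, h1, map_one]
        rw [hg', map_star (contCalc U), contCalc_idFun]
        calc Φ (star idFun)
            = star (U : H →L[ℂ] H) * ((U : H →L[ℂ] H) * Φ (star idFun)) := by
              rw [← mul_assoc, Unitary.star_mul_self_of_mem U.2, one_mul]
          _ = star (U : H →L[ℂ] H) := by rw [h2, mul_one]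
    | algebraMap r => rw [AlgHomClass.commutes, AlgHomClass.commutes]
    | add a b _ _ ha hb => rw [map_add, map_add, ha, hb]
    | mul a b _ _ ha hb => rw [map_mul, map_mul, ha, hb]
  have hdense : f ∈ closure ((StarAlgebra.adjoin ℂ {idFun} : StarSubalgebra ℂ C(UnitCircle, ℂ)) :
      Set C(UnitCircle, ℂ)) := by
    have h := ContinuousMap.elemental_id_eq_top (𝕜 := ℂ) (Metric.sphere (0 : ℂ) 1)
    have hf : f ∈ (⊤ : StarSubalgebra ℂ C(UnitCircle, ℂ)) := trivial
    rw [← h] at hf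
    exact hf
  exact (isClosed_eq hcont hc).closure_subset_iff.2 (fun g hg => key g hg) hdense

/-! ### The spectral measures -/

/-- A real valued continuous function on the circle, seen as complex valued. -/
def toComplexFun (f : C_c(UnitCircle, ℝ)) : C(UnitCircle, ℂ) :=
  ⟨fun z => (f z : ℂ), Complex.continuous_ofReal.comp f.continuous⟩

/-- The functional `f ↦ ⟨x, f(U) x⟩` on real continuous functions (it takes real values there), as
a positive linear functional. -/
def diagFunctional (U : unitary (H →L[ℂ] H)) (x : H) : C_c(UnitCircle, ℝ) →ₚ[ℝ] ℝ :=
  PositiveLinearMap.mk₀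
    { toFun := fun f => (inner ℂ x (contCalc U (toComplexFun f) x)).re
      map_add' := fun f g => by
        have : toComplexFun (f + g) = toComplexFun f + toComplexFun g := by
          ext z; simp [toComplexFun]
        rw [this, map_add, add_apply, inner_add_right, Complex.add_re]
      map_smul' := fun c f => by
        have : toComplexFun (c • f) = (c : ℂ) • toComplexFun f := by
          ext z; simp [toComplexFun]
        rw [this, map_smul, smul_apply, inner_smul_right]
        simp }
    (by
      intro f hf
      let g : C(UnitCircle, ℂ) := ⟨fun z => (Real.sqrt (f z) : ℂ),
        Complex.continuous_ofReal.comp (Real.continuous_sqrt.comp f.continuous)⟩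
      have hg : toComplexFun f = star g * g := by
        ext z
        have hz : 0 ≤ f z := hf z
        simp [toComplexFun, g, ← Complex.ofReal_mul, Real.mul_self_sqrt hz]
      change 0 ≤ (inner ℂ x (contCalc U (toComplexFun f) x)).re
      rw [hg, map_mul, map_star, mul_apply_eq_comp,
        ContinuousLinearMap.star_eq_adjoint, ContinuousLinearMap.adjoint_inner_right]
      exact inner_self_nonneg (𝕜 := ℂ))

/-- The finite positive Borel measure `μ_{x,x}` that represents `f ↦ ⟨x, f(U) x⟩` by the
Riesz-Markov-Kakutani theorem. -/
def diagMeasure (U : unitary (H →L[ℂ] H)) (x : H) : Measure UnitCircle :=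
  RealRMK.rieszMeasure (diagFunctional U x)

instance (U : unitary (H →L[ℂ] H)) (x : H) : IsFiniteMeasure (diagMeasure U x) := by
  unfold diagMeasure; infer_instance

/-- The measure `μ_{x,x}`, as a complex measure. -/
def diagComplex (U : unitary (H →L[ℂ] H)) (x : H) : ComplexMeasure UnitCircle :=
  (diagMeasure U x).toSignedMeasure.toComplexMeasure 0

/-- The spectral measure `μ_{x,y}` of `U`, a complex Borel measure on the circle, obtained from
the measures `μ_{z,z}` by polarization (the inner product is linear in the second variable). -/
def spectralMeasure (U : unitary (H →L[ℂ] H)) (x y : H) : ComplexMeasure UnitCircle :=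
  (1 / 4 : ℂ) • (diagComplex U (x + y) - diagComplex U (x - y)
    - Complex.I • diagComplex U (x + Complex.I • y)
    + Complex.I • diagComplex U (x - Complex.I • y))

/-- The measure `μ_{x,x}` represents `f ↦ ⟨x, f(U) x⟩`. -/
lemma inner_contCalc_eq_integral (U : unitary (H →L[ℂ] H)) (x : H) (g : C_c(UnitCircle, ℝ)) :
    inner ℂ x (contCalc U (toComplexFun g) x) = ((∫ z, g z ∂diagMeasure U x : ℝ) : ℂ) := by
  rw [diagMeasure, RealRMK.integral_rieszMeasure]
  change _ = (((inner ℂ x (contCalc U (toComplexFun g) x)).re : ℝ) : ℂ)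
  have hsa : star (toComplexFun g) = toComplexFun g := by ext z; simp [toComplexFun]
  symm
  rw [← Complex.conj_eq_iff_re, inner_conj_symm, ← ContinuousLinearMap.adjoint_inner_right,
    ← ContinuousLinearMap.star_eq_adjoint, ← map_star, hsa]

lemma diagMeasure_smul (U : unitary (H →L[ℂ] H)) (c : ℂ) (x : H) :
    diagMeasure U (c • x) = (‖c‖₊ ^ 2) • diagMeasure U x := by
  refine ext_of_forall_integral_eq_of_IsFiniteMeasure fun f => ?_
  let a : C_c(UnitCircle, ℝ) := ⟨f.toContinuousMap, HasCompactSupport.of_compactSpace _⟩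
  have h := inner_contCalc_eq_integral U (c • x) a
  rw [map_smul, inner_smul_left, inner_smul_right, inner_contCalc_eq_integral, ← mul_assoc,
    mul_comm _ c, Complex.mul_conj'] at h
  have h2 : ∫ z, a z ∂diagMeasure U (c • x) = ‖c‖ ^ 2 * ∫ z, a z ∂diagMeasure U x := by
    exact_mod_cast h.symm
  rw [integral_smul_nnreal_measure]
  exact h2

lemma diagComplex_apply (U : unitary (H →L[ℂ] H)) (x : H) (E : Set UnitCircle)
    (hE : MeasurableSet E) : diagComplex U x E = ((diagMeasure U x).real E : ℂ) := by
  simp [diagComplex, SignedMeasure.toComplexMeasure_apply, hE]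
  rfl

/-- On the diagonal, polarization gives back the positive measure `μ_{x,x}`. -/
lemma spectralMeasure_self (U : unitary (H →L[ℂ] H)) (x : H) :
    spectralMeasure U x x = diagComplex U x := by
  have h1 : ∀ (c : ℂ) (E : Set UnitCircle), MeasurableSet E →
      diagComplex U (c • x) E = (‖c‖ : ℂ) ^ 2 * diagComplex U x E := by
    intro c E hE
    rw [diagComplex_apply U _ E hE, diagComplex_apply U _ E hE, diagMeasure_smul]
    simp [Measure.real]
  have e1 : x + x = (2 : ℂ) • x := (two_smul ℂ x).symm
  have e2 : x - x = (0 : ℂ) • x := by simp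
  have e3 : x + Complex.I • x = (1 + Complex.I) • x := by rw [add_smul, one_smul]
  have e4 : x - Complex.I • x = (1 - Complex.I) • x := by rw [sub_smul, one_smul]
  have n3 : ((‖1 + Complex.I‖ : ℝ) : ℂ) ^ 2 = 2 := by
    rw [← Complex.mul_conj']; simp; ring_nf; simp; norm_num
  have n4 : ((‖1 - Complex.I‖ : ℝ) : ℂ) ^ 2 = 2 := by
    rw [← Complex.mul_conj']; simp; ring_nf; simp; norm_num
  ext E hE
  rw [spectralMeasure, e1, e2, e3, e4]
  simp only [smul_apply, add_apply, sub_apply, h1 _ E hE, n3, n4]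
  simp
  ring

/-- The integral `∫ f dμ` of a complex function against a complex measure. -/
def complexIntegral (f : UnitCircle → ℂ) (μ : ComplexMeasure UnitCircle) : ℂ :=
  ∫ᵛ z, f z ∂[ContinuousLinearMap.mul ℝ ℂ; μ]

/-! ### The measurable calculus and projection valued measures -/

/-- `Λ` extends the continuous calculus of `U`, and it maps uniformly bounded, pointwise convergent
sequences of bounded Borel functions to sequences that converge in the weak operator topology. -/
structure IsMeasurableCalculus (U : unitary (H →L[ℂ] H))
    (Λ : BoundedBorel →ₗ[ℂ] (H →L[ℂ] H)) : Prop where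
  extends_contCalc : ∀ f : C(UnitCircle, ℂ), Λ (BoundedBorel.ofContinuous f) = contCalc U f
  tendsto_wot : ∀ (f : ℕ → BoundedBorel) (g : BoundedBorel) (C : ℝ),
    (∀ n z, ‖(f n : UnitCircle → ℂ) z‖ ≤ C) →
    (∀ z, Tendsto (fun n => (f n : UnitCircle → ℂ) z) atTop (𝓝 ((g : UnitCircle → ℂ) z))) →
    Tendsto (fun n => ContinuousLinearMapWOT.ofCLM (Λ (f n))) atTop
      (𝓝 (ContinuousLinearMapWOT.ofCLM (Λ g)))

/-- The set function `E ↦ χ_E(U)` on Borel sets (set to `0` on sets that are not Borel). -/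
def pvm (Λ : BoundedBorel →ₗ[ℂ] (H →L[ℂ] H)) (E : Set UnitCircle) : H →L[ℂ] H :=
  open Classical in if hE : MeasurableSet E then Λ (BoundedBorel.charFun E hE) else 0

/-- `μ` is a projection valued measure on the circle: its values on Borel sets are orthogonal
projections, `μ(∅) = 0`, `μ(𝕋) = I`, and `μ` is countably additive in the strong operator
topology. -/
structure IsProjectionValuedMeasure (μ : Set UnitCircle → (H →L[ℂ] H)) : Prop where
  isStarProjection : ∀ E, MeasurableSet E → IsStarProjection (μ E)
  empty : μ ∅ = 0
  univ : μ Set.univ = 1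
  hasSum_iUnion : ∀ E : ℕ → Set UnitCircle, (∀ n, MeasurableSet (E n)) →
    Pairwise (Function.onFun Disjoint E) → ∀ y : H, HasSum (fun n => μ (E n) y) (μ (⋃ n, E n) y)

/-- A null set of `μ` is a Borel set `E` with `μ(E) = 0`. -/
def IsNullSet (μ : Set UnitCircle → (H →L[ℂ] H)) (E : Set UnitCircle) : Prop :=
  MeasurableSet E ∧ μ E = 0

/-- The norm `‖φ‖_{L^∞(μ)} ∈ [0, ∞]`: the least `C` such that `|φ| ≤ C` holds `μ`-almost
everywhere, i.e. outside a null set of `μ`. -/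
def linftyNorm (μ : Set UnitCircle → (H →L[ℂ] H)) (φ : UnitCircle → ℂ) : ℝ≥0∞ :=
  sInf {C : ℝ≥0∞ | IsNullSet μ {z | ¬ ‖φ z‖ₑ ≤ C}}

end UnitaryCalculus

end

/-!
Closing the continuous functions on the circle under bounded pointwise limits of sequences gives all
bounded Borel functions, so two linear maps on the bounded Borel functions that respect such limits
agree once they agree on `C(𝕋)`. This gives uniqueness; it also transports the sesquilinearity of
`(x, y) ↦ ⟨x, f(U) y⟩`, the product rule and the rule for adjoints from continuous to bounded Borel
functions, the product rule by fixing one factor at a time.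

For existence, polarization bounds the form `(x, y) ↦ ∫ f dμ_{x,y}` by a multiple of `‖x‖ ‖y‖`, so
it is the form of a bounded operator `f(U)`. The vectors `μ(Eₙ) y` for disjoint `Eₙ` are orthogonal,
and for orthogonal families weak convergence of the series implies norm convergence. The identity
`‖f(U) μ(E) x‖² = ∫_E |f|² dμ_{x,x}` turns a bound on the operator `f(U)` into an almost everywhere
bound on `f` with respect to every `μ_{x,x}`, and conversely.
-/

noncomputable section

open scoped BoundedContinuousFunction

namespace UnitaryCalculus

/-- Bounded pointwise convergence of a sequence of functions: pointwise convergence together with a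
uniform bound. -/
structure BoundedTendsto {X E : Type*} [NormedAddCommGroup E] (f : ℕ → X → E) (g : X → E) :
    Prop where
  exists_bound : ∃ C : ℝ, ∀ n x, ‖f n x‖ ≤ C
  tendsto : ∀ x, Tendsto (fun n => f n x) atTop (𝓝 (g x))

namespace BoundedTendsto

variable {X : Type*}

lemma exists_norm_limit_le {E : Type*} [NormedAddCommGroup E] {f : ℕ → X → E} {g : X → E}
    (h : BoundedTendsto f g) : ∃ C : ℝ, ∀ x, ‖g x‖ ≤ C := by
  obtain ⟨C, hC⟩ := h.exists_bound
  exact ⟨C, fun x => le_of_tendsto (h.tendsto x).norm (.of_forall fun n => hC n x)⟩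

lemma const_mul {R : Type*} [NormedRing R] {f : ℕ → X → R} {g k : X → R}
    (h : BoundedTendsto f g) (hk : ∃ C : ℝ, ∀ x, ‖k x‖ ≤ C) :
    BoundedTendsto (fun n => k * f n) (k * g) where
  exists_bound := by
    obtain ⟨C, hC⟩ := h.exists_bound
    obtain ⟨D, hD⟩ := hk
    exact ⟨D * C, fun n x => norm_mul_le_of_le (hD x) (hC n x)⟩
  tendsto x := (h.tendsto x).const_mul (k x)

lemma star {E : Type*} [NormedAddCommGroup E] [StarAddMonoid E] [NormedStarGroup E]
    {f : ℕ → X → E} {g : X → E} (h : BoundedTendsto f g) :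
    BoundedTendsto (fun n => star (f n)) (star g) where
  exists_bound := by simpa only [Pi.star_apply, norm_star] using h.exists_bound
  tendsto x := (h.tendsto x).star

end BoundedTendsto

/-- A set of functions is boundedly closed if it is closed under bounded pointwise limits of
sequences. -/
def IsBoundedlyClosed {X E : Type*} [NormedAddCommGroup E] (V : Set (X → E)) : Prop :=
  ∀ (f : ℕ → X → E) (g : X → E), (∀ n, f n ∈ V) → BoundedTendsto f g → g ∈ V

namespace IsBoundedlyClosed

variable {X E : Type*} [NormedAddCommGroup E]

lemma indicator_iUnion_mem {V : AddSubmonoid (X → E)} (hV : IsBoundedlyClosed (V : Set (X → E)))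
    (c : E) {s : ℕ → Set X} (hd : Pairwise (Function.onFun Disjoint s))
    (hs : ∀ n, (s n).indicator (fun _ => c) ∈ V) : (⋃ n, s n).indicator (fun _ => c) ∈ V := by
  have partial_mem (n : ℕ) : (⋃ i ∈ Finset.range n, s i).indicator (fun _ => c) ∈ V := by
    have hsum := V.sum_mem (t := Finset.range n) fun i _ => hs i
    convert hsum
    rw [Finset.indicator_biUnion _ _ fun i _ j _ hij => hd hij]
    exact (Finset.sum_fn _ _).symm
  refine hV _ _ partial_mem ⟨⟨‖c‖, fun n x => norm_indicator_le_norm_self _ _⟩, fun x => ?_⟩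
  exact ((tendsto_indicator_biUnion_finset s _ x).mono_right (pure_le_nhds _)).comp
    tendsto_finset_range

variable [NormedSpace ℝ E]

lemma mem_of_indicator_mem [MeasurableSpace X] {V : AddSubmonoid (X → E)}
    (hV : IsBoundedlyClosed (V : Set (X → E)))
    (hind : ∀ (c : E) (s : Set X), MeasurableSet s → s.indicator (fun _ => c) ∈ V)
    {f : X → E} (hf : StronglyMeasurable f) (hb : ∃ C : ℝ, ∀ x, ‖f x‖ ≤ C) : f ∈ V := by
  have simpleFunc_mem (φ : SimpleFunc X E) : ⇑φ ∈ V := by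
    induction φ using SimpleFunc.induction with
    | const c hs => simpa [Set.piecewise_eq_indicator] using! hind c _ hs
    | add _ hφ hψ => exact V.add_mem hφ hψ
  obtain ⟨C, hC⟩ := hb
  exact hV (fun n => hf.approxBounded (max C 0) n) f (fun n => simpleFunc_mem _)
    ⟨⟨max C 0, hf.norm_approxBounded_le (le_max_right C 0)⟩,
      fun x => hf.tendsto_approxBounded_of_norm_le ((hC x).trans (le_max_left C 0))⟩

variable [TopologicalSpace X] [HasOuterApproxClosed X]

lemma indicator_mem_of_isClosed {V : Set (X → E)} (hV : IsBoundedlyClosed V)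
    (hcont : ∀ f : X →ᵇ E, ⇑f ∈ V) (c : E) {F : Set X} (hF : IsClosed F) :
    F.indicator (fun _ => c) ∈ V := by
  have norm_le (n : ℕ) (x : X) : ‖(hF.apprSeq n x : ℝ) • c‖ ≤ ‖c‖ := by
    rw [norm_smul, NNReal.norm_eq]
    exact mul_le_of_le_one_left (norm_nonneg c) (HasOuterApproxClosed.apprSeq_apply_le_one hF n x)
  refine hV (fun n x => (hF.apprSeq n x : ℝ) • c) _
    (fun n => hcont (.ofNormedAddCommGroup _ (by fun_prop) ‖c‖ (norm_le n)))
    ⟨⟨‖c‖, norm_le⟩, fun x => ?_⟩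
  have indicator_eq : F.indicator (fun _ => c) x =
      ((F.indicator (fun _ => 1) x : NNReal) : ℝ) • c := by
    by_cases hx : x ∈ F <;> simp [hx]
  have hlim := tendsto_pi_nhds.1 (HasOuterApproxClosed.tendsto_apprSeq hF) x
  exact indicator_eq ▸ ((NNReal.continuous_coe.tendsto _).comp hlim).smul_const c

variable [MeasurableSpace X] [BorelSpace X]

lemma indicator_mem_of_continuous_mem {V : AddSubgroup (X → E)}
    (hV : IsBoundedlyClosed (V : Set (X → E)))
    (hcont : ∀ f : X →ᵇ E, ⇑f ∈ V) (c : E) {s : Set X}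
    (hs : MeasurableSet s) : s.indicator (fun _ => c) ∈ V := by
  have hgen : ‹MeasurableSpace X› = MeasurableSpace.generateFrom {s | IsClosed s} :=
    BorelSpace.measurable_eq.trans borel_eq_generateFrom_isClosed
  induction s, hs using MeasurableSpace.induction_on_inter hgen isPiSystem_isClosed with
  | empty => exact (Set.indicator_empty fun _ : X => c) ▸ V.zero_mem
  | basic F hF => exact hV.indicator_mem_of_isClosed hcont c hF
  | compl s _ ih =>
    rw [Set.indicator_compl]
    exact V.sub_mem (hcont (.const X c)) ih
  | iUnion s hd _ ih => exact hV.indicator_iUnion_mem (V := V.toAddSubmonoid) c hd ih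

lemma mem_of_continuous_mem {V : AddSubgroup (X → E)} (hV : IsBoundedlyClosed (V : Set (X → E)))
    (hcont : ∀ f : X →ᵇ E, ⇑f ∈ V) {f : X → E}
    (hf : StronglyMeasurable f) (hb : ∃ C : ℝ, ∀ x, ‖f x‖ ≤ C) : f ∈ V :=
  hV.mem_of_indicator_mem (V := V.toAddSubmonoid)
    (fun c _ hs => hV.indicator_mem_of_continuous_mem hcont c hs) hf hb

end IsBoundedlyClosed

open BoundedBorel ComplexConjugate

namespace BoundedBorel

lemma measurable (f : BoundedBorel) : Measurable f.1 := f.2.1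

lemma exists_bound (f : BoundedBorel) : ∃ C : ℝ, ∀ z, ‖f.1 z‖ ≤ C := f.2.2

lemma integrable (f : BoundedBorel) (μ : Measure UnitCircle) [IsFiniteMeasure μ] :
    Integrable f.1 μ :=
  have ⟨C, hC⟩ := exists_bound f
  .of_bound (measurable f).aestronglyMeasurable C (ae_of_all _ hC)

lemma integrable_norm_sq (f : BoundedBorel) (μ : Measure UnitCircle) [IsFiniteMeasure μ] :
    Integrable (fun z => ‖f.1 z‖ ^ 2) μ :=
  (integrable (f * f) μ).norm.congr (ae_of_all _ fun _ => (norm_mul _ _).trans (sq _).symm)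

end BoundedBorel

/-- A map on the bounded Borel functions is boundedly continuous if it sends bounded pointwise
convergence of sequences to convergence. -/
def IsBoundedlyContinuous {W : Type*} [TopologicalSpace W] (L : BoundedBorel → W) : Prop :=
  ∀ (f : ℕ → BoundedBorel) (g : BoundedBorel), BoundedTendsto (fun n => (f n).1) g.1 →
    Tendsto (fun n => L (f n)) atTop (𝓝 (L g))

namespace IsBoundedlyContinuous

variable {W : Type*} [TopologicalSpace W]

lemma comp {W' : Type*} [TopologicalSpace W'] {φ : W → W'} {L : BoundedBorel → W}
    (hφ : Continuous φ) (hL : IsBoundedlyContinuous L) :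
    IsBoundedlyContinuous fun f => φ (L f) :=
  fun f g h => (hφ.tendsto _).comp (hL f g h)

lemma comp_star {L : BoundedBorel → W} (hL : IsBoundedlyContinuous L) :
    IsBoundedlyContinuous fun f => L (star f) :=
  fun _ _ h => hL _ _ h.star

lemma comp_const_mul {L : BoundedBorel → W} (hL : IsBoundedlyContinuous L) (k : BoundedBorel) :
    IsBoundedlyContinuous fun f => L (k * f) :=
  fun _ _ h => hL _ _ (h.const_mul (exists_bound k))

variable [T2Space W]

lemma isBoundedlyClosed_eqLocus {L M : BoundedBorel → W} (hL : IsBoundedlyContinuous L)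
    (hM : IsBoundedlyContinuous M) : IsBoundedlyClosed (Subtype.val '' {f | L f = M f}) := by
  intro f g hf hfg
  choose f' hLM hf' using hf
  obtain rfl : (fun n => (f' n).1) = f := funext hf'
  let g' : BoundedBorel := ⟨g, measurable_of_tendsto_metrizable (fun n => measurable (f' n))
    (tendsto_pi_nhds.2 hfg.tendsto), hfg.exists_norm_limit_le⟩
  refine ⟨g', tendsto_nhds_unique (hL f' g' hfg) ?_, rfl⟩
  exact (hM f' g' hfg).congr fun n => (hLM n).symm

lemma ext_continuous [AddMonoid W] {L M : BoundedBorel →+ W} (hL : IsBoundedlyContinuous L)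
    (hM : IsBoundedlyContinuous M) (h : ∀ f, L (ofContinuous f) = M (ofContinuous f)) : L = M := by
  let V := (L.eqLocus M).map (BoundedBorel.subtype : BoundedBorel →+ UnitCircle → ℂ)
  have hV : IsBoundedlyClosed (V : Set (UnitCircle → ℂ)) := hL.isBoundedlyClosed_eqLocus hM
  ext f
  obtain ⟨f', hf', hval⟩ := hV.mem_of_continuous_mem
    (fun φ => ⟨ofContinuous φ, h φ, rfl⟩) (measurable f).stronglyMeasurable (exists_bound f)
  exact Subtype.val_injective hval ▸ hf'

lemma ext_charFun [AddCommMonoid W] [Module ℂ W] {L M : BoundedBorel →ₗ[ℂ] W}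
    (hL : IsBoundedlyContinuous L) (hM : IsBoundedlyContinuous M)
    (h : ∀ E hE, L (charFun E hE) = M (charFun E hE)) : L = M := by
  let V := (LinearMap.eqLocus L M).toAddSubmonoid.map
    (BoundedBorel.subtype : BoundedBorel →+ UnitCircle → ℂ)
  have hV : IsBoundedlyClosed (V : Set (UnitCircle → ℂ)) := hL.isBoundedlyClosed_eqLocus hM
  have indicator_mem (c : ℂ) (E : Set UnitCircle) (hE : MeasurableSet E) :
      E.indicator (fun _ => c) ∈ V := by
    refine ⟨c • charFun E hE, (LinearMap.eqLocus L M).smul_mem c (h E hE), ?_⟩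
    ext z
    by_cases hz : z ∈ E <;> simp [BoundedBorel.charFun, hz]
  ext f
  obtain ⟨f', hf', hval⟩ := hV.mem_of_indicator_mem indicator_mem
    (measurable f).stronglyMeasurable (exists_bound f)
  exact Subtype.val_injective hval ▸ hf'

open ContinuousLinearMapWOT in
lemma ext_continuous_wot {E F : Type*} [NormedAddCommGroup E] [NormedSpace ℂ E]
    [NormedAddCommGroup F] [NormedSpace ℂ F] {A B : BoundedBorel →+ (E →L[ℂ] F)}
    (hA : IsBoundedlyContinuous fun f => ofCLM (A f))
    (hB : IsBoundedlyContinuous fun f => ofCLM (B f))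
    (h : ∀ f, A (ofContinuous f) = B (ofContinuous f)) : A = B := by
  let toWOT : (E →L[ℂ] F) →+ (E →WOT[ℂ] F) := addEquiv.symm.toAddMonoidHom
  have eq_toWOT : toWOT.comp A = toWOT.comp B :=
    ext_continuous hA hB fun f => congrArg ofCLM (h f)
  ext1 f
  exact ofCLM_injective (DFunLike.congr_fun eq_toWOT f)

end IsBoundedlyContinuous

/-- The linear functional `f ↦ ∫ f dμ` of a finite measure `μ`. -/
def integralₗ (μ : Measure UnitCircle) [IsFiniteMeasure μ] : BoundedBorel →ₗ[ℂ] ℂ where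
  toFun f := ∫ z, f.1 z ∂μ
  map_add' f g := integral_add (integrable f μ) (integrable g μ)
  map_smul' c f := integral_const_mul c f.1

lemma isBoundedlyContinuous_integralₗ (μ : Measure UnitCircle) [IsFiniteMeasure μ] :
    IsBoundedlyContinuous (integralₗ μ) := by
  rintro f g ⟨⟨C, hC⟩, hlim⟩
  exact tendsto_integral_of_dominated_convergence (fun _ => C)
    (fun n => (measurable (f n)).aestronglyMeasurable) (integrable_const C)
    (fun n => ae_of_all _ (hC n)) (ae_of_all _ hlim)

lemma integralₗ_charFun (μ : Measure UnitCircle) [IsFiniteMeasure μ] (E : Set UnitCircle)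
    (hE : MeasurableSet E) : integralₗ μ (charFun E hE) = (μ.real E : ℂ) := by
  change ∫ z, E.indicator 1 z ∂μ = _
  rw [integral_indicator hE, Pi.one_def, setIntegral_const, Complex.real_smul, mul_one]

section ComplexMeasure

variable (μ : ComplexMeasure UnitCircle) [IsFiniteMeasure μ.variation]

/-- The linear functional `f ↦ ∫ f dμ` of a complex measure `μ` of finite variation. -/
def complexIntegralₗ : BoundedBorel →ₗ[ℂ] ℂ where
  toFun f := complexIntegral f.1 μ
  map_add' f g :=
    VectorMeasure.integral_add (integrable f μ.variation) (integrable g μ.variation)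
  map_smul' c f := by
    change complexIntegral (c • f.1) μ = c • complexIntegral f.1 μ
    simp only [complexIntegral, VectorMeasure.integral_eq_setToFun]
    exact setToFun_smul _ (fun c s w => smul_mul_assoc c w (μ s)) c f.1

lemma isBoundedlyContinuous_complexIntegralₗ : IsBoundedlyContinuous (complexIntegralₗ μ) := by
  rintro f g ⟨⟨C, hC⟩, hlim⟩
  exact tendsto_setToFun_of_dominated_convergence _ (fun _ => C)
    (fun n => (measurable (f n)).aestronglyMeasurable) (integrable_const C)
    (fun n => ae_of_all _ (hC n)) (ae_of_all _ hlim)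

lemma complexIntegralₗ_charFun (E : Set UnitCircle) (hE : MeasurableSet E) :
    complexIntegralₗ μ (charFun E hE) = μ E := by
  change complexIntegral (E.indicator fun _ => 1) μ = μ E
  rw [complexIntegral, VectorMeasure.integral_eq_setToFun,
    setToFun_indicator_const _ hE (measure_ne_top _ _)]
  exact one_mul (μ E)

end ComplexMeasure

variable {H : Type*} [NormedAddCommGroup H] [InnerProductSpace ℂ H]

lemma pvm_of_measurableSet (Λ : BoundedBorel →ₗ[ℂ] (H →L[ℂ] H)) {E : Set UnitCircle}
    (hE : MeasurableSet E) : pvm Λ E = Λ (charFun E hE) := dif_pos hE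

variable [CompleteSpace H]

section SpectralMeasures

variable (U : unitary (H →L[ℂ] H))

instance (x : H) : IsFiniteMeasure (diagComplex U x).variation := by
  refine isFiniteMeasure_of_le (diagMeasure U x)
    (VectorMeasure.variation_le_of_forall_enorm_le fun E hE => ?_)
  rw [diagComplex_apply U x E hE, ← ofReal_norm, Complex.norm_real,
    Real.norm_of_nonneg measureReal_nonneg, ofReal_measureReal]

instance (x y : H) : IsFiniteMeasure (spectralMeasure U x y).variation := by
  have finite_add (μ ν : ComplexMeasure UnitCircle) (_ : IsFiniteMeasure μ.variation)
      (_ : IsFiniteMeasure ν.variation) : IsFiniteMeasure (μ + ν).variation :=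
    isFiniteMeasure_of_le _ VectorMeasure.variation_add_le
  have finite_sub (μ ν : ComplexMeasure UnitCircle) (_ : IsFiniteMeasure μ.variation)
      (_ : IsFiniteMeasure ν.variation) : IsFiniteMeasure (μ - ν).variation :=
    isFiniteMeasure_of_le _ VectorMeasure.variation_sub_le
  have finite_sum := finite_add _ (Complex.I • diagComplex U (x - Complex.I • y))
    (finite_sub _ (Complex.I • diagComplex U (x + Complex.I • y))
      (finite_sub (diagComplex U (x + y)) (diagComplex U (x - y)) inferInstance inferInstance)
      inferInstance) inferInstance
  unfold spectralMeasure
  infer_instance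

lemma integralₗ_diagMeasure_ofContinuous (x : H) (f : C(UnitCircle, ℂ)) :
    integralₗ (diagMeasure U x) (ofContinuous f) = inner ℂ x (contCalc U f x) := by
  have of_real (g : C_c(UnitCircle, ℝ)) :
      integralₗ (diagMeasure U x) (ofContinuous (toComplexFun g)) =
        inner ℂ x (contCalc U (toComplexFun g) x) := by
    rw [inner_contCalc_eq_integral, ← integral_complex_ofReal]
    rfl
  let re : C_c(UnitCircle, ℝ) :=
    ⟨⟨fun z => (f z).re, by fun_prop⟩, HasCompactSupport.of_compactSpace _⟩
  let im : C_c(UnitCircle, ℝ) :=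
    ⟨⟨fun z => (f z).im, by fun_prop⟩, HasCompactSupport.of_compactSpace _⟩
  have re_add_im : toComplexFun re + Complex.I • toComplexFun im = f := by
    ext z
    change ((f z).re : ℂ) + Complex.I * ((f z).im : ℂ) = f z
    rw [mul_comm, Complex.re_add_im]
  have ofContinuous_re_add_im : ofContinuous (toComplexFun re + Complex.I • toComplexFun im) =
      ofContinuous (toComplexFun re) + Complex.I • ofContinuous (toComplexFun im) := rfl
  rw [← re_add_im, ofContinuous_re_add_im, map_add, map_smul, of_real, of_real, map_add, map_smul,
    add_apply, smul_apply, inner_add_right, inner_smul_right, smul_eq_mul]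

lemma complexIntegralₗ_spectralMeasure (x y : H) :
    complexIntegralₗ (spectralMeasure U x y) = (1 / 4 : ℂ) •
      (integralₗ (diagMeasure U (x + y)) - integralₗ (diagMeasure U (x - y))
        - Complex.I • integralₗ (diagMeasure U (x + Complex.I • y))
        + Complex.I • integralₗ (diagMeasure U (x - Complex.I • y))) := by
  refine (isBoundedlyContinuous_complexIntegralₗ _).ext_charFun (fun f g h => ?_) fun E hE => ?_
  · have tendsto_diag (w : H) := isBoundedlyContinuous_integralₗ (diagMeasure U w) f g h
    exact ((((tendsto_diag _).sub (tendsto_diag _)).sub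
      ((tendsto_diag _).const_smul Complex.I)).add
        ((tendsto_diag _).const_smul Complex.I)).const_smul (1 / 4 : ℂ)
  · simp only [complexIntegralₗ_charFun, spectralMeasure, smul_apply, add_apply, sub_apply,
      diagComplex_apply U _ E hE, LinearMap.smul_apply, LinearMap.add_apply, LinearMap.sub_apply,
      integralₗ_charFun]

lemma complexIntegralₗ_spectralMeasure_self (x : H) :
    complexIntegralₗ (spectralMeasure U x x) = integralₗ (diagMeasure U x) :=
  (isBoundedlyContinuous_complexIntegralₗ _).ext_charFun (isBoundedlyContinuous_integralₗ _)
    fun E hE => by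
      rw [complexIntegralₗ_charFun, spectralMeasure_self, diagComplex_apply U x E hE,
        integralₗ_charFun]

lemma complexIntegralₗ_spectralMeasure_ofContinuous (x y : H) (f : C(UnitCircle, ℂ)) :
    complexIntegralₗ (spectralMeasure U x y) (ofContinuous f) = inner ℂ x (contCalc U f y) := by
  simp only [complexIntegralₗ_spectralMeasure, LinearMap.smul_apply, LinearMap.add_apply,
    LinearMap.sub_apply, integralₗ_diagMeasure_ofContinuous, map_add, map_sub, map_smul,
    inner_add_left, inner_sub_left, inner_add_right, inner_sub_right, inner_smul_left,
    inner_smul_right, smul_eq_mul, Complex.conj_I]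
  linear_combination
    (inner ℂ y (contCalc U f x) - inner ℂ x (contCalc U f y)) / 2 * Complex.I_sq

lemma diagMeasure_real_univ (x : H) : (diagMeasure U x).real Set.univ = ‖x‖ ^ 2 := by
  have integral_one : integralₗ (diagMeasure U x) (ofContinuous 1) =
      ((diagMeasure U x).real Set.univ : ℂ) := by
    change ∫ _, (1 : ℂ) ∂diagMeasure U x = _
    rw [integral_const, Complex.real_smul, mul_one]
  refine Complex.ofReal_injective (integral_one.symm.trans ?_)
  rw [integralₗ_diagMeasure_ofContinuous, map_one, one_apply_eq_self, inner_self_eq_norm_sq_to_K]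
  exact (Complex.ofReal_pow ‖x‖ 2).symm

end SpectralMeasures

section Sesquilinear

variable {E G : Type*}

lemma sesquilinear_polarization [AddCommGroup E] [Module ℂ E] [AddCommGroup G] [Module ℂ G]
    (B : E →ₗ⋆[ℂ] E →ₗ[ℂ] G) (x y : E) :
    (4 : ℂ) • B x y = B (x + y) (x + y) - B (x - y) (x - y)
      - Complex.I • B (x + Complex.I • y) (x + Complex.I • y)
      + Complex.I • B (x - Complex.I • y) (x - Complex.I • y) := by
  simp only [map_add, map_sub, map_smulₛₗ, LinearMap.add_apply, LinearMap.sub_apply,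
    LinearMap.smul_apply, Complex.conj_I, RingHom.id_apply]
  linear_combination (norm := module) Complex.I_mul_I • ((2 : ℂ) • (B x y - B y x))

variable [NormedAddCommGroup E] [NormedSpace ℂ E] [NormedAddCommGroup G] [NormedSpace ℂ G]
  {B : E →ₗ⋆[ℂ] E →ₗ[ℂ] G} {C : ℝ}

lemma norm_sesquilinear_le_of_norm_eq (hB : ∀ x, ‖B x x‖ ≤ C * ‖x‖ ^ 2) {x y : E}
    (hxy : ‖x‖ = ‖y‖) : ‖B x y‖ ≤ 4 * C * ‖x‖ * ‖y‖ := by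
  rcases eq_or_ne x 0 with rfl | hx
  · simp
  have hC : 0 ≤ C := nonneg_of_mul_nonneg_left ((norm_nonneg _).trans (hB x)) (by positivity)
  have diagonal_le {z : E} (hz : ‖z‖ ≤ ‖x‖ + ‖y‖) : ‖B z z‖ ≤ C * (‖x‖ + ‖y‖) ^ 2 :=
    (hB z).trans (by gcongr)
  have norm_I_smul : ‖Complex.I • y‖ = ‖y‖ := by rw [norm_smul, Complex.norm_I, one_mul]
  have four_mul_le : 4 * ‖B x y‖ ≤ C * (‖x‖ + ‖y‖) ^ 2 + C * (‖x‖ + ‖y‖) ^ 2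
      + C * (‖x‖ + ‖y‖) ^ 2 + C * (‖x‖ + ‖y‖) ^ 2 := by
    rw [← RCLike.norm_ofNat (K := ℂ) 4, ← norm_smul, sesquilinear_polarization]
    refine norm_add_le_of_le (norm_sub_le_of_le (norm_sub_le_of_le ?_ ?_) ?_) ?_
    · exact diagonal_le (norm_add_le x y)
    · exact diagonal_le (norm_sub_le x y)
    · rw [norm_smul, Complex.norm_I, one_mul]
      exact diagonal_le (norm_I_smul ▸ norm_add_le x _)
    · rw [norm_smul, Complex.norm_I, one_mul]
      exact diagonal_le (norm_I_smul ▸ norm_sub_le x _)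
  rw [hxy] at four_mul_le ⊢
  linarith

lemma norm_sesquilinear_le (hB : ∀ x, ‖B x x‖ ≤ C * ‖x‖ ^ 2) (x y : E) :
    ‖B x y‖ ≤ 4 * C * ‖x‖ * ‖y‖ := by
  rcases eq_or_ne x 0 with rfl | hx
  · simp
  rcases eq_or_ne y 0 with rfl | hy
  · simp
  have norm_eq : ‖(‖y‖ : ℂ) • x‖ = ‖(‖x‖ : ℂ) • y‖ := by
    simp only [norm_smul, Complex.norm_real, norm_norm, mul_comm]
  have rescaled := norm_sesquilinear_le_of_norm_eq hB norm_eq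
  simp only [map_smulₛₗ, RingHom.id_apply, LinearMap.smul_apply, norm_smul, Complex.conj_ofReal,
    Complex.norm_real, norm_norm] at rescaled
  refine le_of_mul_le_mul_left ?_ (mul_pos (norm_pos_iff.2 hx) (norm_pos_iff.2 hy))
  linarith

end Sesquilinear

section SpectralForm

variable (U : unitary (H →L[ℂ] H))

lemma eq_complexIntegralₗ_spectralMeasure {L : BoundedBorel →ₗ[ℂ] ℂ}
    (hL : IsBoundedlyContinuous L) {x y : H}
    (h : ∀ f, L (ofContinuous f) = inner ℂ x (contCalc U f y)) :
    L = complexIntegralₗ (spectralMeasure U x y) :=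
  LinearMap.toAddMonoidHom_injective <|
    hL.ext_continuous (L := L.toAddMonoidHom) (M := LinearMap.toAddMonoidHom _)
      (isBoundedlyContinuous_complexIntegralₗ _) fun f =>
        (h f).trans (complexIntegralₗ_spectralMeasure_ofContinuous U x y f).symm

lemma complexIntegralₗ_spectralMeasure_add_left (x x' y : H) :
    complexIntegralₗ (spectralMeasure U (x + x') y) =
      complexIntegralₗ (spectralMeasure U x y) + complexIntegralₗ (spectralMeasure U x' y) := by
  refine (eq_complexIntegralₗ_spectralMeasure U (fun f g h => ?_) fun f => ?_).symm
  · exact (isBoundedlyContinuous_complexIntegralₗ _ f g h).add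
      (isBoundedlyContinuous_complexIntegralₗ _ f g h)
  · simp only [LinearMap.add_apply, complexIntegralₗ_spectralMeasure_ofContinuous, inner_add_left]

lemma complexIntegralₗ_spectralMeasure_add_right (x y y' : H) :
    complexIntegralₗ (spectralMeasure U x (y + y')) =
      complexIntegralₗ (spectralMeasure U x y) + complexIntegralₗ (spectralMeasure U x y') := by
  refine (eq_complexIntegralₗ_spectralMeasure U (fun f g h => ?_) fun f => ?_).symm
  · exact (isBoundedlyContinuous_complexIntegralₗ _ f g h).add
      (isBoundedlyContinuous_complexIntegralₗ _ f g h)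
  · simp only [LinearMap.add_apply, complexIntegralₗ_spectralMeasure_ofContinuous, map_add,
      inner_add_right]

lemma complexIntegralₗ_spectralMeasure_smul_left (c : ℂ) (x y : H) :
    complexIntegralₗ (spectralMeasure U (c • x) y) =
      conj c • complexIntegralₗ (spectralMeasure U x y) := by
  refine (eq_complexIntegralₗ_spectralMeasure U (fun f g h => ?_) fun f => ?_).symm
  · exact (isBoundedlyContinuous_complexIntegralₗ _ f g h).const_smul (conj c)
  · simp only [LinearMap.smul_apply, complexIntegralₗ_spectralMeasure_ofContinuous,
      inner_smul_left, smul_eq_mul]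

lemma complexIntegralₗ_spectralMeasure_smul_right (c : ℂ) (x y : H) :
    complexIntegralₗ (spectralMeasure U x (c • y)) =
      c • complexIntegralₗ (spectralMeasure U x y) := by
  refine (eq_complexIntegralₗ_spectralMeasure U (fun f g h => ?_) fun f => ?_).symm
  · exact (isBoundedlyContinuous_complexIntegralₗ _ f g h).const_smul c
  · simp only [LinearMap.smul_apply, complexIntegralₗ_spectralMeasure_ofContinuous, map_smul,
      inner_smul_right, smul_eq_mul]

/-- The sesquilinear form `(x, y) ↦ ∫ f dμ_{x,y}`, which is the form of the operator `f(U)`. -/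
def spectralForm (f : BoundedBorel) : H →ₗ⋆[ℂ] H →ₗ[ℂ] ℂ :=
  LinearMap.mk₂'ₛₗ (starRingEnd ℂ) (RingHom.id ℂ)
    (fun x y => complexIntegralₗ (spectralMeasure U x y) f)
    (fun x x' y => DFunLike.congr_fun (complexIntegralₗ_spectralMeasure_add_left U x x' y) f)
    (fun c x y => DFunLike.congr_fun (complexIntegralₗ_spectralMeasure_smul_left U c x y) f)
    (fun x y y' => DFunLike.congr_fun (complexIntegralₗ_spectralMeasure_add_right U x y y') f)
    (fun c x y => DFunLike.congr_fun (complexIntegralₗ_spectralMeasure_smul_right U c x y) f)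

lemma norm_spectralForm_self_le {f : BoundedBorel} {C : ℝ} (hC : ∀ z, ‖f.1 z‖ ≤ C) (x : H) :
    ‖spectralForm U f x x‖ ≤ C * ‖x‖ ^ 2 := by
  change ‖complexIntegralₗ (spectralMeasure U x x) f‖ ≤ _
  rw [complexIntegralₗ_spectralMeasure_self, ← diagMeasure_real_univ U x]
  exact norm_integral_le_of_norm_le_const (ae_of_all _ hC)

lemma exists_inner_eq_spectralForm (f : BoundedBorel) :
    ∃ T : H →L[ℂ] H, ∀ x y, inner ℂ x (T y) = spectralForm U f x y := by
  obtain ⟨C, hC⟩ := exists_bound f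
  let B : H →L⋆[ℂ] H →L[ℂ] ℂ := (spectralForm U f).mkContinuous₂ (4 * C)
    (norm_sesquilinear_le (norm_spectralForm_self_le U hC))
  refine ⟨star (InnerProductSpace.continuousLinearMapOfBilin B), fun x y => ?_⟩
  rw [ContinuousLinearMap.star_eq_adjoint, ContinuousLinearMap.adjoint_inner_right,
    InnerProductSpace.continuousLinearMapOfBilin_apply]
  rfl

theorem exists_isMeasurableCalculus :
    ∃ Λ : BoundedBorel →ₗ[ℂ] (H →L[ℂ] H), IsMeasurableCalculus U Λ := by
  choose T hT using exists_inner_eq_spectralForm U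
  have inner_T (f : BoundedBorel) (x y : H) :
      inner ℂ x (T f y) = complexIntegralₗ (spectralMeasure U x y) f := hT f x y
  refine ⟨⟨⟨T, fun f g => ?_⟩, fun c f => ?_⟩, fun f => ?_, fun f g C hC hlim => ?_⟩
  · refine ContinuousLinearMap.ext fun y => ext_inner_left ℂ fun x => ?_
    simp only [add_apply, inner_add_right, inner_T, map_add]
  · refine ContinuousLinearMap.ext fun y => ext_inner_left ℂ fun x => ?_
    simp only [RingHom.id_apply, smul_apply, inner_smul_right, inner_T, map_smul, smul_eq_mul]
  · refine ContinuousLinearMap.ext fun y => ext_inner_left ℂ fun x => ?_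
    exact (inner_T _ x y).trans (complexIntegralₗ_spectralMeasure_ofContinuous U x y f)
  · refine ContinuousLinearMapWOT.tendsto_iff_forall_inner_apply_tendsto.2 fun y x => ?_
    change Tendsto (fun n => inner ℂ x (T (f n) y)) atTop (𝓝 (inner ℂ x (T g y)))
    simp only [inner_T]
    exact isBoundedlyContinuous_complexIntegralₗ _ f g ⟨⟨C, hC⟩, hlim⟩

end SpectralForm

lemma hasSum_of_hasSum_inner_of_orthogonal {𝕜 E ι : Type*} [RCLike 𝕜] [NormedAddCommGroup E]
    [InnerProductSpace 𝕜 E] {v : ι → E} {w : E} (hv : Pairwise fun i j => inner 𝕜 (v i) (v j) = 0)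
    (hw : ∀ x, HasSum (fun i => inner 𝕜 x (v i)) (inner 𝕜 x w)) : HasSum v w := by
  have inner_v_w (i : ι) : inner 𝕜 (v i) w = inner 𝕜 (v i) (v i) :=
    (hw (v i)).unique (hasSum_single i fun j hj => hv hj.symm)
  have inner_sum_sub (s : Finset ι) : inner 𝕜 (∑ i ∈ s, v i) (w - ∑ i ∈ s, v i) = 0 := by
    refine (sum_inner s v _).trans (Finset.sum_eq_zero fun i hi => ?_)
    rw [inner_sub_right, inner_v_w, inner_sum, sub_eq_zero, eq_comm]
    exact Finset.sum_eq_single_of_mem i hi fun j _ hj => hv hj.symm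
  have norm_sub_sq (s : Finset ι) : ‖w - ∑ i ∈ s, v i‖ ^ 2 =
      ‖inner 𝕜 w w - ∑ i ∈ s, inner 𝕜 w (v i)‖ := by
    rw [← inner_sum, ← inner_sub_right, ← sub_zero (inner 𝕜 w _), ← inner_sum_sub s,
      ← inner_sub_left, inner_self_eq_norm_sq_to_K, norm_pow, norm_algebraMap', norm_norm]
  have norm_sub_sq_tendsto : Tendsto (fun s => ‖w - ∑ i ∈ s, v i‖ ^ 2) atTop (𝓝 0) := by
    simpa only [norm_sub_sq, sub_self, norm_zero, SummationFilter.unconditional_filter]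
      using ((hw w).const_sub (inner 𝕜 w w)).norm
  refine tendsto_iff_norm_sub_tendsto_zero.2 ?_
  simpa [norm_sub_rev w] using norm_sub_sq_tendsto.sqrt

lemma charFun_mul_charFun {E F : Set UnitCircle} (hE : MeasurableSet E) (hF : MeasurableSet F) :
    charFun E hE * charFun F hF = charFun (E ∩ F) (hE.inter hF) :=
  Subtype.ext Set.inter_indicator_one.symm

lemma star_charFun {E : Set UnitCircle} (hE : MeasurableSet E) :
    star (charFun E hE) = charFun E hE :=
  Subtype.ext <| funext fun z => by
    by_cases hz : z ∈ E <;> simp [BoundedBorel.charFun, hz]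

namespace IsMeasurableCalculus

variable {U : unitary (H →L[ℂ] H)} {Λ : BoundedBorel →ₗ[ℂ] (H →L[ℂ] H)}
  {E F : Set UnitCircle}

lemma isBoundedlyContinuous (hΛ : IsMeasurableCalculus U Λ) :
    IsBoundedlyContinuous fun f => ContinuousLinearMapWOT.ofCLM (Λ f) :=
  fun f g ⟨⟨C, hC⟩, hlim⟩ => hΛ.tendsto_wot f g C hC hlim

lemma inner_apply (hΛ : IsMeasurableCalculus U Λ) (f : BoundedBorel) (x y : H) :
    inner ℂ x (Λ f y) = complexIntegral f.1 (spectralMeasure U x y) := by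
  let L : BoundedBorel →ₗ[ℂ] ℂ :=
    { toFun := fun f => inner ℂ x (Λ f y)
      map_add' := fun f g => by rw [map_add, add_apply, inner_add_right]
      map_smul' := fun c f => by rw [map_smul, smul_apply, inner_smul_right]; rfl }
  have hL : IsBoundedlyContinuous L := fun f g h =>
    ContinuousLinearMapWOT.tendsto_iff_forall_inner_apply_tendsto.1
      (hΛ.isBoundedlyContinuous f g h) y x
  refine DFunLike.congr_fun (eq_complexIntegralₗ_spectralMeasure U hL fun φ => ?_) f
  exact congrArg (fun T : H →L[ℂ] H => inner ℂ x (T y)) (hΛ.extends_contCalc φ)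

lemma unique (hΛ : IsMeasurableCalculus U Λ) {Λ' : BoundedBorel →ₗ[ℂ] (H →L[ℂ] H)}
    (hΛ' : IsMeasurableCalculus U Λ') : Λ = Λ' :=
  LinearMap.ext fun f => ContinuousLinearMap.ext fun y => ext_inner_left ℂ fun x => by
    rw [hΛ.inner_apply, hΛ'.inner_apply]

lemma inner_self_apply (hΛ : IsMeasurableCalculus U Λ) (f : BoundedBorel) (x : H) :
    inner ℂ x (Λ f x) = ∫ z, f.1 z ∂diagMeasure U x :=
  (hΛ.inner_apply f x x).trans
    (DFunLike.congr_fun (complexIntegralₗ_spectralMeasure_self U x) f)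

lemma star_apply (hΛ : IsMeasurableCalculus U Λ) (f : BoundedBorel) : star (Λ f) = Λ (star f) := by
  let Λhom : BoundedBorel →+ (H →L[ℂ] H) := Λ
  let starOperator : (H →L[ℂ] H) →+ (H →L[ℂ] H) := starAddEquiv.toAddMonoidHom
  let starFun : BoundedBorel →+ BoundedBorel := starAddEquiv.toAddMonoidHom
  have star_comp : starOperator.comp Λhom = Λhom.comp starFun :=
    IsBoundedlyContinuous.ext_continuous_wot
      (hΛ.isBoundedlyContinuous.comp (φ := star) continuous_star)
      hΛ.isBoundedlyContinuous.comp_star fun φ => by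
        change star (Λ (ofContinuous φ)) = Λ (ofContinuous (star φ))
        rw [hΛ.extends_contCalc, hΛ.extends_contCalc, map_star]
  exact DFunLike.congr_fun star_comp f

lemma mul_apply (hΛ : IsMeasurableCalculus U Λ) (f g : BoundedBorel) :
    Λ (f * g) = Λ f * Λ g := by
  let Λhom : BoundedBorel →+ (H →L[ℂ] H) := Λ
  have mul_ofContinuous (φ : C(UnitCircle, ℂ)) :
      Λhom.comp (AddMonoidHom.mulLeft (ofContinuous φ)) =
        (AddMonoidHom.mulLeft (Λ (ofContinuous φ))).comp Λhom :=
    IsBoundedlyContinuous.ext_continuous_wot (hΛ.isBoundedlyContinuous.comp_const_mul _)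
      (hΛ.isBoundedlyContinuous.comp (φ := fun T => .ofCLM (Λ (ofContinuous φ)) * T)
        (continuous_const_mul _)) fun ψ => by
        change Λ (ofContinuous (φ * ψ)) = Λ (ofContinuous φ) * Λ (ofContinuous ψ)
        rw [hΛ.extends_contCalc, hΛ.extends_contCalc, hΛ.extends_contCalc, map_mul]
  have mul_right : Λhom.comp (AddMonoidHom.mulLeft g) = (AddMonoidHom.mulRight (Λ g)).comp Λhom :=
    IsBoundedlyContinuous.ext_continuous_wot (hΛ.isBoundedlyContinuous.comp_const_mul _)
      (hΛ.isBoundedlyContinuous.comp (φ := fun T => T * .ofCLM (Λ g))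
        (continuous_mul_const _)) fun φ => by
        change Λ (g * ofContinuous φ) = Λ (ofContinuous φ) * Λ g
        rw [mul_comm]
        exact DFunLike.congr_fun (mul_ofContinuous φ) g
  rw [mul_comm f g]
  exact DFunLike.congr_fun mul_right f

lemma norm_apply_sq (hΛ : IsMeasurableCalculus U Λ) (f : BoundedBorel) (x : H) :
    ‖Λ f x‖ ^ 2 = ∫ z, ‖f.1 z‖ ^ 2 ∂diagMeasure U x := by
  refine Complex.ofReal_injective ?_
  calc ((‖Λ f x‖ ^ 2 : ℝ) : ℂ)
      = inner ℂ (Λ f x) (Λ f x) := by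
        rw [inner_self_eq_norm_sq_to_K]
        exact Complex.ofReal_pow _ 2
    _ = inner ℂ x (Λ (star f * f) x) := by
        rw [hΛ.mul_apply, ← hΛ.star_apply, mul_apply_eq_comp, ContinuousLinearMap.star_eq_adjoint,
          ContinuousLinearMap.adjoint_inner_right]
    _ = ∫ z, conj (f.1 z) * f.1 z ∂diagMeasure U x := hΛ.inner_self_apply _ x
    _ = ((∫ z, ‖f.1 z‖ ^ 2 ∂diagMeasure U x : ℝ) : ℂ) := by
        simp only [Complex.conj_mul', ← Complex.ofReal_pow]
        exact integral_complex_ofReal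

lemma inner_pvm (hΛ : IsMeasurableCalculus U Λ) (hE : MeasurableSet E) (x y : H) :
    inner ℂ x (pvm Λ E y) = spectralMeasure U x y E := by
  rw [pvm_of_measurableSet Λ hE, hΛ.inner_apply]
  exact complexIntegralₗ_charFun _ E hE

lemma pvm_mul_pvm (hΛ : IsMeasurableCalculus U Λ) (hE : MeasurableSet E) (hF : MeasurableSet F) :
    pvm Λ E * pvm Λ F = pvm Λ (E ∩ F) := by
  rw [pvm_of_measurableSet Λ hE, pvm_of_measurableSet Λ hF, ← hΛ.mul_apply,
    charFun_mul_charFun hE hF, pvm_of_measurableSet Λ (hE.inter hF)]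

lemma isStarProjection_pvm (hΛ : IsMeasurableCalculus U Λ) (hE : MeasurableSet E) :
    IsStarProjection (pvm Λ E) where
  isIdempotentElem := by rw [IsIdempotentElem, hΛ.pvm_mul_pvm hE hE, Set.inter_self]
  isSelfAdjoint := by
    rw [IsSelfAdjoint, pvm_of_measurableSet Λ hE, hΛ.star_apply, star_charFun]

lemma pvm_empty (hΛ : IsMeasurableCalculus U Λ) : pvm Λ ∅ = 0 :=
  ContinuousLinearMap.ext fun y => ext_inner_left ℂ fun x => by
    rw [hΛ.inner_pvm .empty, VectorMeasure.empty, zero_apply, inner_zero_right]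

lemma pvm_univ (hΛ : IsMeasurableCalculus U Λ) : pvm Λ Set.univ = 1 := by
  have charFun_univ : charFun Set.univ .univ = ofContinuous 1 :=
    Subtype.ext (Set.indicator_univ 1)
  rw [pvm_of_measurableSet Λ .univ, charFun_univ, hΛ.extends_contCalc, map_one]

lemma inner_pvm_pvm_of_disjoint (hΛ : IsMeasurableCalculus U Λ) (hE : MeasurableSet E)
    (hF : MeasurableSet F) (hEF : Disjoint E F) (y : H) :
    inner ℂ (pvm Λ E y) (pvm Λ F y) = 0 := by
  rw [← ContinuousLinearMap.adjoint_inner_right, ← ContinuousLinearMap.star_eq_adjoint,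
    (hΛ.isStarProjection_pvm hE).isSelfAdjoint.star_eq, ← mul_apply_eq_comp,
    hΛ.pvm_mul_pvm hE hF, hEF.inter_eq, hΛ.pvm_empty, zero_apply, inner_zero_right]

theorem isProjectionValuedMeasure (hΛ : IsMeasurableCalculus U Λ) :
    IsProjectionValuedMeasure (pvm Λ) where
  isStarProjection _ hE := hΛ.isStarProjection_pvm hE
  empty := hΛ.pvm_empty
  univ := hΛ.pvm_univ
  hasSum_iUnion E hE hd y := by
    refine hasSum_of_hasSum_inner_of_orthogonal (𝕜 := ℂ)
      (fun i j hij => hΛ.inner_pvm_pvm_of_disjoint (hE i) (hE j) (hd hij) y) fun x => ?_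
    simpa only [hΛ.inner_pvm (.iUnion hE), hΛ.inner_pvm (hE _)] using
      (spectralMeasure U x y).hasSum_of_disjoint_iUnion hE hd

lemma norm_apply_pvm_sq (hΛ : IsMeasurableCalculus U Λ) (f : BoundedBorel)
    (hE : MeasurableSet E) (x : H) :
    ‖Λ f (pvm Λ E x)‖ ^ 2 = ∫ z in E, ‖f.1 z‖ ^ 2 ∂diagMeasure U x := by
  rw [pvm_of_measurableSet Λ hE, ← mul_apply_eq_comp, ← hΛ.mul_apply, hΛ.norm_apply_sq,
    ← integral_indicator hE]
  refine integral_congr_ae (ae_of_all _ fun z => ?_)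
  by_cases hz : z ∈ E <;> simp [BoundedBorel.charFun, hz]

lemma norm_pvm_sq (hΛ : IsMeasurableCalculus U Λ) (hE : MeasurableSet E) (x : H) :
    ‖pvm Λ E x‖ ^ 2 = (diagMeasure U x).real E := by
  have h := hΛ.norm_apply_pvm_sq (ofContinuous 1) hE x
  rw [hΛ.extends_contCalc, map_one, one_apply_eq_self] at h
  rw [h]
  simp [ofContinuous]

lemma pvm_eq_zero_iff (hΛ : IsMeasurableCalculus U Λ) (hE : MeasurableSet E) :
    pvm Λ E = 0 ↔ ∀ x, diagMeasure U x E = 0 := by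
  have apply_eq_zero_iff (x : H) : pvm Λ E x = 0 ↔ diagMeasure U x E = 0 := by
    rw [← measureReal_eq_zero_iff, ← hΛ.norm_pvm_sq hE, sq_eq_zero_iff, norm_eq_zero]
  simp only [ContinuousLinearMap.ext_iff, zero_apply, apply_eq_zero_iff]

lemma pvm_eq_zero_iff_spectralMeasure (hΛ : IsMeasurableCalculus U Λ) (hE : MeasurableSet E) :
    pvm Λ E = 0 ↔ ∀ x y, spectralMeasure U x y E = 0 := by
  refine ⟨fun h x y => by rw [← hΛ.inner_pvm hE, h, zero_apply, inner_zero_right], fun h => ?_⟩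
  refine ContinuousLinearMap.ext fun y => ext_inner_left ℂ fun x => ?_
  rw [hΛ.inner_pvm hE, h, zero_apply, inner_zero_right]

lemma pvm_eq_zero_iff_hilbertBasis (hΛ : IsMeasurableCalculus U Λ) (hE : MeasurableSet E)
    {ι : Type*} (e : HilbertBasis ι ℂ H) :
    pvm Λ E = 0 ↔ ∀ α β, spectralMeasure U (e α) (e β) E = 0 := by
  refine ⟨fun h α β => (hΛ.pvm_eq_zero_iff_spectralMeasure hE).1 h _ _, fun h => ?_⟩
  refine ContinuousLinearMap.ext_on
    (Submodule.dense_iff_topologicalClosure_eq_top.2 e.dense_span) ?_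
  rintro _ ⟨β, rfl⟩
  refine e.repr.injective (lp.ext <| funext fun α => ?_)
  rw [HilbertBasis.repr_apply_apply, HilbertBasis.repr_apply_apply, hΛ.inner_pvm hE, h, zero_apply,
    inner_zero_right]

lemma isNullSet_pvm_iff (hΛ : IsMeasurableCalculus U Λ) {φ : UnitCircle → ℂ} (hφ : Measurable φ)
    (C : ℝ≥0∞) :
    IsNullSet (pvm Λ) {z | ¬ ‖φ z‖ₑ ≤ C} ↔ ∀ x, ∀ᵐ z ∂diagMeasure U x, ‖φ z‖ₑ ≤ C := by
  have hE : MeasurableSet {z | ¬ ‖φ z‖ₑ ≤ C} := (measurableSet_le hφ.enorm measurable_const).compl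
  simp only [IsNullSet, hE, true_and, hΛ.pvm_eq_zero_iff hE, ae_iff]

lemma linftyNorm_pvm_le_iff (hΛ : IsMeasurableCalculus U Λ) {φ : UnitCircle → ℂ}
    (hφ : Measurable φ) (C : ℝ≥0∞) :
    linftyNorm (pvm Λ) φ ≤ C ↔ ∀ x, ∀ᵐ z ∂diagMeasure U x, ‖φ z‖ₑ ≤ C := by
  refine ⟨fun h x => ?_, fun h => sInf_le ((hΛ.isNullSet_pvm_iff hφ C).2 h)⟩
  have essSup_le : eLpNormEssSup φ (diagMeasure U x) ≤ linftyNorm (pvm Λ) φ :=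
    le_sInf fun D hD => eLpNormEssSup_le_of_ae_enorm_bound ((hΛ.isNullSet_pvm_iff hφ D).1 hD x)
  filter_upwards [enorm_ae_le_eLpNormEssSup φ (diagMeasure U x)] with z hz
  exact hz.trans (essSup_le.trans h)

theorem linftyNorm_pvm (hΛ : IsMeasurableCalculus U Λ) {φ : UnitCircle → ℂ} (hφ : Measurable φ) :
    linftyNorm (pvm Λ) φ = ⨆ x : H, eLpNorm φ ∞ (diagMeasure U x) := by
  refine eq_of_forall_ge_iff fun C => ?_
  simp only [hΛ.linftyNorm_pvm_le_iff hφ, iSup_le_iff, eLpNorm_exponent_top]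
  refine forall_congr' fun x => ⟨eLpNormEssSup_le_of_ae_enorm_bound, fun h => ?_⟩
  exact (enorm_ae_le_eLpNormEssSup φ _).mono fun _ hz => hz.trans h

lemma norm_apply_le_of_ae_le (hΛ : IsMeasurableCalculus U Λ) {f : BoundedBorel} {C : ℝ}
    (hC : 0 ≤ C) (h : ∀ x, ∀ᵐ z ∂diagMeasure U x, ‖f.1 z‖ ≤ C) : ‖Λ f‖ ≤ C := by
  refine ContinuousLinearMap.opNorm_le_bound _ hC fun x => ?_
  refine le_of_sq_le_sq ?_ (by positivity)
  calc ‖Λ f x‖ ^ 2 = ∫ z, ‖f.1 z‖ ^ 2 ∂diagMeasure U x := hΛ.norm_apply_sq f x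
    _ ≤ ∫ _, C ^ 2 ∂diagMeasure U x := by
      refine integral_mono_of_nonneg (ae_of_all _ fun z => by positivity) (integrable_const _) ?_
      exact (h x).mono fun z hz => pow_le_pow_left₀ (norm_nonneg _) hz 2
    _ = (C * ‖x‖) ^ 2 := by
      rw [integral_const, diagMeasure_real_univ, smul_eq_mul, mul_pow, mul_comm]

lemma ae_norm_le (hΛ : IsMeasurableCalculus U Λ) (f : BoundedBorel) (x : H) :
    ∀ᵐ z ∂diagMeasure U x, ‖f.1 z‖ ≤ ‖Λ f‖ := by
  have sq_le : ∀ᵐ z ∂diagMeasure U x, ‖f.1 z‖ ^ 2 ≤ ‖Λ f‖ ^ 2 := by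
    refine ae_le_of_forall_setIntegral_le (integrable_norm_sq f _) (integrable_const _)
      fun E hE _ => ?_
    calc ∫ z in E, ‖f.1 z‖ ^ 2 ∂diagMeasure U x = ‖Λ f (pvm Λ E x)‖ ^ 2 :=
        (hΛ.norm_apply_pvm_sq f hE x).symm
      _ ≤ (‖Λ f‖ * ‖pvm Λ E x‖) ^ 2 := pow_le_pow_left₀ (norm_nonneg _) ((Λ f).le_opNorm _) 2
      _ = ∫ _ in E, ‖Λ f‖ ^ 2 ∂diagMeasure U x := by
        rw [setIntegral_const, mul_pow, hΛ.norm_pvm_sq hE, smul_eq_mul, mul_comm]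
  exact sq_le.mono fun z hz => le_of_sq_le_sq hz (norm_nonneg _)

theorem enorm_apply_eq_linftyNorm (hΛ : IsMeasurableCalculus U Λ) (f : BoundedBorel) :
    ‖Λ f‖ₑ = linftyNorm (pvm Λ) f.1 := by
  refine eq_of_forall_ge_iff fun C => ?_
  rw [hΛ.linftyNorm_pvm_le_iff (measurable f)]
  induction C with
  | top => exact iff_of_true le_top fun _ => ae_of_all _ fun _ => le_top
  | coe C =>
    simp only [enorm_le_coe, ← NNReal.coe_le_coe, coe_nnnorm]
    exact ⟨fun h x => (hΛ.ae_norm_le f x).mono fun _ hz => hz.trans h,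
      hΛ.norm_apply_le_of_ae_le C.2⟩

end IsMeasurableCalculus

end UnitaryCalculus
end

open UnitaryCalculus in
theorem mainTheorem5 {H : Type*} [NormedAddCommGroup H] [InnerProductSpace ℂ H] [CompleteSpace H]
    (U : unitary (H →L[ℂ] H)) :
    -- existence and uniqueness of the measurable calculus
    (∃! Λ : BoundedBorel →ₗ[ℂ] (H →L[ℂ] H), IsMeasurableCalculus U Λ) ∧
    ∀ Λ : BoundedBorel →ₗ[ℂ] (H →L[ℂ] H), IsMeasurableCalculus U Λ →
      -- it is a homomorphism of star-algebras
      (∀ f g : BoundedBorel, Λ (f * g) = Λ f * Λ g) ∧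
      (∀ f : BoundedBorel, star (Λ f) = Λ (star f)) ∧
      -- it is given by integration against the spectral measures
      (∀ (f : BoundedBorel) (x y : H), (spectralMeasure U x y).Integrable f.1 ∧
        inner ℂ x (Λ f y) = complexIntegral f.1 (spectralMeasure U x y)) ∧
      -- the operators `χ_E(U)` form a projection valued measure
      IsProjectionValuedMeasure (pvm Λ) ∧
      (∀ E : Set UnitCircle, MeasurableSet E → ∀ x y : H,
        inner ℂ x (pvm Λ E y) = spectralMeasure U x y E) ∧
      -- its null sets
      (∀ E : Set UnitCircle, MeasurableSet E →
        [pvm Λ E = 0,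
          ∀ x : H, diagMeasure U x E = 0,
          ∀ x y : H, spectralMeasure U x y E = 0].TFAE ∧
        ∀ (ι : Type*) (e : HilbertBasis ι ℂ H),
          (pvm Λ E = 0 ↔ ∀ α β : ι, spectralMeasure U (e α) (e β) E = 0)) ∧
      -- its essential supremum norm
      (∀ φ : UnitCircle → ℂ, Measurable φ →
        linftyNorm (pvm Λ) φ = ⨆ x : H, eLpNorm φ ∞ (diagMeasure U x)) ∧
      (∀ f : BoundedBorel, ‖Λ f‖ₑ = linftyNorm (pvm Λ) f.1) := by
  refine ⟨?_, fun Λ hΛ => ⟨hΛ.mul_apply, hΛ.star_apply,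
    fun f x y => ⟨BoundedBorel.integrable f _, hΛ.inner_apply f x y⟩,
    hΛ.isProjectionValuedMeasure, fun E hE => hΛ.inner_pvm hE, fun E hE => ⟨?_, ?_⟩,
    fun φ hφ => hΛ.linftyNorm_pvm hφ, hΛ.enorm_apply_eq_linftyNorm⟩⟩
  · obtain ⟨Λ, hΛ⟩ := exists_isMeasurableCalculus U
    exact ⟨Λ, hΛ, fun Λ' hΛ' => hΛ'.unique hΛ⟩
  · tfae_have 1 ↔ 2 := hΛ.pvm_eq_zero_iff hE
    tfae_have 1 ↔ 3 := hΛ.pvm_eq_zero_iff_spectralMeasure hE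
    tfae_finish
  · exact fun ι e => hΛ.pvm_eq_zero_iff_hilbertBasis hE e
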